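/- Let $I=[0,1]$. Positive reals $r,\rho$ are said to \emph{never connect} if $r<1<\rho$ and, for all integers $k,l$, $r^k=\rho^l$ if and only if $k=l=0$. Let $M\ge 2$ and let $\Omega=\{\omega_1,\dots,\omega_M\}$ be a set of positive real numbers that is \emph{LF-inducing}, i.e. $\omega_1<1<\omega_2$ and $\omega_1,\omega_2$ never connect. Put $$F_\Omega=\bigcup_{j=1}^M\{(x,y)\in I^2: y=\omega_j x\},\qquad I_{F_\Omega}^+=\Big\{(x_1,x_2,\dots)\in\prod_{i=1}^\infty I:\ (x_i,x_{i+1})\in F_\Omega\text{ for all } i\ge 1\Big\},$$ the latter with the product topology. Then $I_{F_\Omega}^+$ is a Lelek fan, i.e. a smooth fan whose set of end-points is dense. Here a \emph{continuum} is a nonempty compact connected metrizable space; a \emph{dendroid} is an arcwise connected continuum in which the intersection of any two subcontinua whose union is a subcontinuum is connected (hereditary unicoherence); a \emph{ramification point} is a common end-point of three arcs any two of which meet only in that point; a \emph{fan} is a dendroid with exactly one ramification point $v$, its top; a fan is \emph{smooth} if $x_n\to x$ implies that the arcs $[v,x_n]$ converge to the arc $[v,x]$ in the Hausdorff metric (with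 $[v,v]=\{v\}$); an \emph{end-point} is a point that is an end-point of every arc containing it. -/

import Mathlib

open Set Filter Topology TopologicalSpace
open scoped unitInterval

/-- Points of `X^ℕ` all of whose consecutive coordinates are related by `G`; as a subspace of the
product space this is the one-sided infinite Mahavier product `X_G^+` (coordinates are numbered
from `0`). -/
def MahavierProduct {X : Type*} (G : Set (X × X)) : Set (ℕ → X) :=
  {x | ∀ i, (x i, x (i + 1)) ∈ G}

/-- `r` and `ρ` never connect. -/
structure NeverConnect (r ρ : ℝ) : Prop where
  pos : 0 < r
  lt_one : r < 1
  one_lt : 1 < ρ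
  zpow_eq_iff : ∀ k l : ℤ, r ^ k = ρ ^ l ↔ k = 0 ∧ l = 0

/-- A finite set of positive numbers that contains a never-connecting pair. -/
structure LFInducing (Ω : Finset ℝ) : Prop where
  pos : ∀ ω ∈ Ω, 0 < ω
  exists_neverConnect : ∃ ω₁ ∈ Ω, ∃ ω₂ ∈ Ω, NeverConnect ω₁ ω₂

/-- The union of the lines `y = ω x`, `ω ∈ Ω`, in the unit square. -/
def lineRelation (Ω : Finset ℝ) : Set (I × I) :=
  ⋃ ω ∈ Ω, {p | (p.2 : ℝ) = ω * (p.1 : ℝ)}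

section Continua

variable {X : Type*} [TopologicalSpace X]

/-- `A` is an arc with end-points `x` and `y`. -/
def IsArcBetween (A : Set X) (x y : X) : Prop :=
  ∃ h : I ≃ₜ A, (h 0 : X) = x ∧ (h 1 : X) = y

/-- `A` is an arc. -/
def IsArc (A : Set X) : Prop := Nonempty (I ≃ₜ A)

/-- `x` is an end-point of the arc `A`. -/
def IsEndpointOfArc (A : Set X) (x : X) : Prop := ∃ y, IsArcBetween A x y

/-- Nonempty compact connected subsets. -/
def IsSubcontinuum (K : Set X) : Prop := IsCompact K ∧ IsConnected K

/-- `K` is not the union of two subcontinua with disconnected intersection. -/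
def IsUnicoherent (K : Set X) : Prop :=
  ∀ A B : Set X, IsSubcontinuum A → IsSubcontinuum B → A ∪ B = K → IsConnected (A ∩ B)

/-- `x` is an end-point of every arc that contains it. -/
def IsEndpoint (x : X) : Prop := ∀ A : Set X, IsArc A → x ∈ A → IsEndpointOfArc A x

/-- `x` is the top of a simple triod: a common end-point of three arcs that pairwise meet only
in `x`. -/
def IsRamificationPoint (x : X) : Prop :=
  ∃ A B C : Set X, IsEndpointOfArc A x ∧ IsEndpointOfArc B x ∧ IsEndpointOfArc C x ∧
    A ∩ B = {x} ∧ A ∩ C = {x} ∧ B ∩ C = {x}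

/-- The (in a dendroid, unique) arc from `x` to `y`, read as `{x}` if `x = y`. -/
def IsSegment (A : Set X) (x y : X) : Prop :=
  (x ≠ y ∧ IsArcBetween A x y) ∨ (x = y ∧ A = {x})

variable (X)

/-- Nonempty compact connected metrizable spaces. -/
structure IsContinuum : Prop where
  compact : CompactSpace X
  connected : ConnectedSpace X
  metrizable : MetrizableSpace X

/-- Arcwise connected, hereditarily unicoherent continua. -/
structure IsDendroid : Prop extends IsContinuum X where
  arcwise_connected : ∀ x y : X, x ≠ y → ∃ A : Set X, IsArcBetween A x y
  hereditarily_unicoherent : ∀ K : Set X, IsSubcontinuum K → IsUnicoherent K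

/-- Dendroids with exactly one ramification point, the top. -/
structure IsFan : Prop extends IsDendroid X where
  existsUnique_top : ∃! v : X, IsRamificationPoint v

/-- Fans with top `v` such that `x n → x` implies that the arcs `[v, x n]` converge to `[v, x]`.
The topology on `NonemptyCompacts X` is the one of the Hausdorff metric (for any compatible metric
on `X`). -/
structure IsSmoothFan : Prop extends IsFan X where
  smooth : ∀ v : X, IsRamificationPoint v →
    ∀ (x : ℕ → X) (x₀ : X), Tendsto x atTop (𝓝 x₀) →
      ∀ (A : ℕ → NonemptyCompacts X) (A₀ : NonemptyCompacts X),
        (∀ n, IsSegment (A n : Set X) v (x n)) → IsSegment (A₀ : Set X) v x₀ →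
          Tendsto A atTop (𝓝 A₀)

/-- Smooth fans with a dense set of end-points. -/
structure IsLelekFan : Prop extends IsSmoothFan X where
  dense_endpoints : Dense {x : X | IsEndpoint x}

end Continua

/-! ### Powers of a never-connecting pair -/

/-! A path is fixed by its initial coordinate and its slopes, and multiplying all coordinates by `t
∈ [0,1]` gives a path again. So the space is a union of segments ("legs") issuing from the zero
path, which will be the top.

The topology rests on `scale_mem_of_isPreconnected`. Each ratio `coord x i / coord x 0` takes
finitely many values, so agreeing with a given leg in finitely many ratios is a clopen condition
away from the origin. Hence a closed connected set can leave the outer part of a leg only along that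
leg. Any two points therefore lie in a connected set contained in every closed connected set through
both (`exists_connector`), which gives hereditary unicoherence. The same principle shows that arcs
leave a nonzero point only inward or outward along its leg, so that no nonzero point is a
ramification point, and that the arc from the origin to `x` is the leg of `x`. The leg varies
continuously with `x`, which is smoothness.

A nonzero path with some coordinate equal to 1 cannot be prolonged outward, so it is an end-point.
Such paths are dense: the numbers `r ^ k * ρ ^ l` are dense in the positive reals, so after a
scaling by some `c` close to 1 the initial part of a path can be continued with slopes `r` and `ρ`
until it hits 1 exactly. -/

theorem NeverConnect.irrational_log_div_log {r ρ : ℝ} (h : NeverConnect r ρ) :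
    Irrational (Real.log r / Real.log ρ) := by
  have hρ : 0 < Real.log ρ := Real.log_pos h.one_lt
  rintro ⟨q, hq⟩
  have hden : (q.den : ℝ) ≠ 0 := by exact_mod_cast q.den_ne_zero
  have hlog : (q.den : ℝ) * Real.log r = q.num * Real.log ρ := by
    rw [Rat.cast_def, div_eq_div_iff hden hρ.ne'] at hq
    linarith
  have hpow : r ^ (q.den : ℤ) = ρ ^ q.num := by
    apply Real.log_injOn_pos (zpow_pos h.pos _) (zpow_pos (zero_lt_one.trans h.one_lt) _)
    rw [Real.log_zpow, Real.log_zpow]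
    exact_mod_cast hlog
  have := ((h.zpow_eq_iff _ _).1 hpow).1
  exact q.den_ne_zero (by exact_mod_cast this)

/-- The products `r ^ k * ρ ^ l` of a never-connecting pair are dense in the positive reals. -/
theorem NeverConnect.exists_pow_mul_pow_mem_Ioo {r ρ : ℝ} (h : NeverConnect r ρ) {a b : ℝ}
    (ha : 0 < a) (hab : a < b) : ∃ k l : ℕ, r ^ k * ρ ^ l ∈ Ioo a b := by
  have hρ : 0 < Real.log ρ := Real.log_pos h.one_lt
  have hr : Real.log r < 0 := Real.log_neg h.pos h.lt_one
  have : Fact (0 < Real.log ρ) := ⟨hρ⟩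
  -- Kronecker's theorem on the circle of length `log ρ`. Natural multiples are needed because
  -- inverse slopes are not available.
  have hdense : DenseRange fun n : ℕ => n • (Real.log r : AddCircle (Real.log ρ)) :=
    denseRange_zsmul_iff_nsmul.1 (AddCircle.denseRange_zsmul_coe_iff.2 h.irrational_log_div_log)
  -- Reserving `K` factors `r` moves the target interval into the positive reals, which forces the
  -- exponent `m` of `ρ` to be positive.
  obtain ⟨K, hK⟩ := exists_nat_gt (-Real.log a / -Real.log r)
  rw [div_lt_iff₀ (by linarith)] at hK
  have hlog : Real.log a < Real.log b := Real.log_lt_log ha hab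
  obtain ⟨k, v, hv, hvk⟩ := hdense.exists_mem_open
    (QuotientAddGroup.isOpenMap_coe (N := AddSubgroup.zmultiples (Real.log ρ))
      (Ioo (Real.log a - K * Real.log r) (Real.log b - K * Real.log r)) isOpen_Ioo)
    ((nonempty_Ioo.2 (by linarith)).image _)
  have hvk' : ((v - k * Real.log r : ℝ) : AddCircle (Real.log ρ)) = 0 := by
    rw [AddCircle.coe_sub, ← nsmul_eq_mul, AddCircle.coe_nsmul, sub_eq_zero]
    exact hvk
  obtain ⟨m, hm⟩ := AddCircle.coe_eq_zero_iff _ |>.1 hvk'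
  rw [zsmul_eq_mul] at hm
  have hkr : (k : ℝ) * Real.log r ≤ 0 := mul_nonpos_of_nonneg_of_nonpos (by positivity) hr.le
  have hm0 : (0 : ℝ) < m := by
    refine pos_of_mul_pos_left (b := Real.log ρ) ?_ hρ.le
    rw [hm]; linarith [hv.1]
  lift m to ℕ using by exact_mod_cast hm0.le
  have hrp : 0 < r ^ (k + K) := pow_pos h.pos _
  have hρp : 0 < ρ ^ m := pow_pos (zero_lt_one.trans h.one_lt) _
  have hval : Real.log (r ^ (k + K) * ρ ^ m) = v + K * Real.log r := by
    rw [Real.log_mul hrp.ne' hρp.ne', Real.log_pow, Real.log_pow]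
    push_cast at hm ⊢
    linarith
  refine ⟨k + K, m, ?_, ?_⟩
  · rw [← Real.log_lt_log_iff ha (mul_pos hrp hρp), hval]; linarith [hv.1]
  · rw [← Real.log_lt_log_iff (mul_pos hrp hρp) (ha.trans hab), hval]; linarith [hv.2]

/-! ### Arcs -/

section Arcs

variable {X : Type*} [TopologicalSpace X]

theorem IsArcBetween.symm {A : Set X} {x y : X} (h : IsArcBetween A x y) : IsArcBetween A y x := by
  obtain ⟨e, h0, h1⟩ := h
  exact ⟨unitInterval.symmHomeomorph.trans e, by simpa using h1, by simpa using h0⟩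

theorem isArcBetween_range [T2Space X] {f : I → X} (hf : Continuous f)
    (hinj : Function.Injective f) : IsArcBetween (range f) (f 0) (f 1) :=
  ⟨(hf.isClosedEmbedding hinj).isEmbedding.toHomeomorph, rfl, rfl⟩

theorem IsArcBetween.exists_param {A : Set X} {x y : X} (h : IsArcBetween A x y) :
    ∃ f : I → X, IsEmbedding f ∧ range f = A ∧ f 0 = x ∧ f 1 = y := by
  obtain ⟨e, h0, h1⟩ := h
  refine ⟨fun t => e t, IsEmbedding.subtypeVal.comp e.isEmbedding, ?_, h0, h1⟩
  ext z
  exact ⟨fun ⟨t, ht⟩ => ht ▸ (e t).2, fun hz => ⟨e.symm ⟨z, hz⟩, by simp⟩⟩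

theorem IsArcBetween.isSubcontinuum {A : Set X} {x y : X} (h : IsArcBetween A x y) :
    IsSubcontinuum A := by
  obtain ⟨f, hf, rfl, -, -⟩ := h.exists_param
  exact ⟨isCompact_range hf.continuous, isConnected_range hf.continuous⟩

theorem IsArcBetween.left_mem {A : Set X} {x y : X} (h : IsArcBetween A x y) : x ∈ A := by
  obtain ⟨f, -, rfl, rfl, -⟩ := h.exists_param
  exact mem_range_self _

theorem IsArcBetween.ne {A : Set X} {x y : X} (h : IsArcBetween A x y) : x ≠ y := by
  obtain ⟨f, hf, -, rfl, rfl⟩ := h.exists_param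
  exact hf.injective.ne zero_ne_one

/-- An arc is irreducible between its end-points. -/
theorem IsArcBetween.subset_of_isPreconnected {A S : Set X} {x y : X} (h : IsArcBetween A x y)
    (hSA : S ⊆ A) (hS : IsPreconnected S) (hx : x ∈ S) (hy : y ∈ S) : A ⊆ S := by
  obtain ⟨f, hf, rfl, rfl, rfl⟩ := h.exists_param
  have hpre : IsPreconnected (f ⁻¹' S) := by
    rw [← hf.isInducing.isPreconnected_image, image_preimage_eq_of_subset hSA]
    exact hS
  rintro _ ⟨t, rfl⟩
  exact hpre.Icc_subset hx hy t.2

end Arcs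

/-! ### The Mahavier product of a union of lines -/

/-- The space of infinite paths in a union of lines through the origin. -/
abbrev LinePaths (Ω : Finset ℝ) : Type := MahavierProduct (lineRelation Ω)

namespace LinePaths

variable {Ω : Finset ℝ}

theorem mem_lineRelation {p : I × I} :
    p ∈ lineRelation Ω ↔ ∃ ω ∈ Ω, (p.2 : ℝ) = ω * (p.1 : ℝ) := by
  simp [lineRelation]

/-- The coordinates, as real numbers. -/
def coord (x : LinePaths Ω) (i : ℕ) : ℝ := x.1 i

theorem coord_nonneg (x : LinePaths Ω) (i : ℕ) : 0 ≤ coord x i := (x.1 i).2.1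

theorem coord_le_one (x : LinePaths Ω) (i : ℕ) : coord x i ≤ 1 := (x.1 i).2.2

theorem coord_succ (x : LinePaths Ω) (i : ℕ) : ∃ ω ∈ Ω, coord x (i + 1) = ω * coord x i :=
  mem_lineRelation.1 (x.2 i)

theorem coord_ext {x y : LinePaths Ω} (h : ∀ i, coord x i = coord y i) : x = y :=
  Subtype.ext (funext fun i => Subtype.ext (h i))

@[fun_prop]
theorem continuous_coord (i : ℕ) : Continuous fun x : LinePaths Ω => coord x i :=
  continuous_subtype_val.comp ((continuous_apply i).comp continuous_subtype_val)

theorem exists_coord_eq (f : ℕ → ℝ) (hf : ∀ i, f i ∈ Icc (0 : ℝ) 1)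
    (hΩ : ∀ i, ∃ ω ∈ Ω, f (i + 1) = ω * f i) : ∃ x : LinePaths Ω, ∀ i, coord x i = f i :=
  ⟨⟨fun i => ⟨f i, hf i⟩, fun i => mem_lineRelation.2 (hΩ i)⟩, fun _ => rfl⟩

/-- Multiplication of all coordinates by a number in the unit interval. -/
def scale (t : I) (x : LinePaths Ω) : LinePaths Ω :=
  ⟨fun i => t * x.1 i, fun i => by
    obtain ⟨ω, hω, h⟩ := mem_lineRelation.1 (x.2 i)
    refine mem_lineRelation.2 ⟨ω, hω, ?_⟩
    simp only [Icc.coe_mul] at h ⊢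
    rw [h]; ring⟩

@[simp]
theorem coord_scale (t : I) (x : LinePaths Ω) (i : ℕ) : coord (scale t x) i = t * coord x i :=
  rfl

theorem continuous_scale : Continuous fun p : I × LinePaths Ω => scale p.1 p.2 := by
  refine Continuous.subtype_mk (continuous_pi fun i => ?_) _
  exact continuous_fst.mul
    ((continuous_apply i).comp (continuous_subtype_val.comp continuous_snd))

@[simp]
theorem scale_one (x : LinePaths Ω) : scale 1 x = x := coord_ext fun i => by simp

theorem continuous_scale_left (x : LinePaths Ω) : Continuous fun t => scale t x :=
  continuous_scale.comp (continuous_id.prodMk continuous_const)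

theorem scale_left_injective {x : LinePaths Ω} (hx : 0 < coord x 0) :
    Function.Injective fun t => scale t x := by
  intro s t h
  have := congrArg (coord · 0) h
  simp only [coord_scale] at this
  exact Subtype.ext (mul_right_cancel₀ hx.ne' this)

theorem coord_eq_zero {x : LinePaths Ω} (hx : coord x 0 = 0) (i : ℕ) : coord x i = 0 := by
  induction i with
  | zero => exact hx
  | succ i ih =>
    obtain ⟨ω, -, h⟩ := coord_succ x i
    rw [h, ih, mul_zero]

theorem eq_of_coord_zero {x y : LinePaths Ω} (hx : coord x 0 = 0) (hy : coord y 0 = 0) : x = y :=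
  coord_ext fun i => by rw [coord_eq_zero hx, coord_eq_zero hy]

theorem coord_pos (hΩ : ∀ ω ∈ Ω, 0 < ω) {x : LinePaths Ω} (hx : 0 < coord x 0) (i : ℕ) :
    0 < coord x i := by
  induction i with
  | zero => exact hx
  | succ i ih =>
    obtain ⟨ω, hω, h⟩ := coord_succ x i
    rw [h]
    exact mul_pos (hΩ ω hω) ih

theorem isClosed_lineRelation : IsClosed (lineRelation Ω) :=
  Ω.finite_toSet.isClosed_biUnion fun _ _ => isClosed_eq (by fun_prop) (by fun_prop)

instance : CompactSpace (LinePaths Ω) := by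
  refine isCompact_iff_compactSpace.1 (IsClosed.isCompact ?_)
  have : MahavierProduct (lineRelation Ω) =
      ⋂ i, (fun x : ℕ → I => (x i, x (i + 1))) ⁻¹' lineRelation Ω := by
    ext x
    simp [MahavierProduct]
  rw [this]
  exact isClosed_iInter fun i => isClosed_lineRelation.preimage (by fun_prop)

/-- Two points are proportional, that is, they lie on a common leg. -/
def SameLeg (x y : LinePaths Ω) : Prop := ∀ i, coord y i * coord x 0 = coord x i * coord y 0

theorem SameLeg.symm {x y : LinePaths Ω} (h : SameLeg x y) : SameLeg y x := fun i => by
  linarith [h i]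

theorem sameLeg_of_coord_zero {y : LinePaths Ω} (x : LinePaths Ω) (hy : coord y 0 = 0) :
    SameLeg x y := fun i => by rw [coord_eq_zero hy, hy]; ring

theorem SameLeg.eq_scale {x y : LinePaths Ω} (h : SameLeg x y) (hx : 0 < coord x 0) {t : I}
    (ht : coord y 0 = t * coord x 0) : y = scale t x := coord_ext fun i => by
  have := h i
  rw [ht] at this
  rw [coord_scale]
  apply mul_right_cancel₀ hx.ne'
  linarith

theorem sameLeg_of_scale_eq_scale {x y : LinePaths Ω} {s t : I} (hs : 0 < s) (ht : 0 < t)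
    (h : scale s x = scale t y) : SameLeg x y := fun i => by
  have h0 := congrArg (coord · 0) h
  have hi := congrArg (coord · i) h
  simp only [coord_scale] at h0 hi
  have hs' : (0 : ℝ) < s := hs
  have ht' : (0 : ℝ) < t := ht
  have : (s : ℝ) * t * (coord y i * coord x 0 - coord x i * coord y 0) = 0 := by
    linear_combination (t * coord y i) * h0 - (t * coord y 0) * hi
  rcases mul_eq_zero.1 this with h | h
  · exact absurd h (mul_pos hs' ht').ne'
  · linarith

/-- The ratio of a coordinate to the initial one takes finitely many values. -/
theorem exists_finite_ratios (Ω : Finset ℝ) (i : ℕ) :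
    ∃ W : Set ℝ, W.Finite ∧ ∀ x : LinePaths Ω, ∃ w ∈ W, coord x i = w * coord x 0 := by
  induction i with
  | zero => exact ⟨{1}, finite_singleton _, fun x => ⟨1, rfl, (one_mul _).symm⟩⟩
  | succ i ih =>
    obtain ⟨W, hW, h⟩ := ih
    refine ⟨image2 (· * ·) Ω W, Ω.finite_toSet.image2 _ hW, fun x => ?_⟩
    obtain ⟨w, hw, hxw⟩ := h x
    obtain ⟨ω, hω, hxω⟩ := coord_succ x i
    exact ⟨ω * w, mem_image2_of_mem hω hw, by rw [hxω, hxw, mul_assoc]⟩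

/-- Disagreement means having one of the finitely many other ratios, which is a closed condition.
The origin satisfies all of these equations at once, hence the restriction to `0 < coord z 0`. -/
theorem exists_isOpen_agree {x : LinePaths Ω} (hx : 0 < coord x 0) (i : ℕ) :
    ∃ U : Set (LinePaths Ω), IsOpen U ∧ ∀ z : LinePaths Ω, 0 < coord z 0 →
      (z ∈ U ↔ coord z i * coord x 0 = coord x i * coord z 0) := by
  obtain ⟨W, hW, hWx⟩ := exists_finite_ratios Ω i
  refine ⟨(⋃ w ∈ W \ {coord x i / coord x 0}, {z | coord z i = w * coord z 0})ᶜ,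
    (hW.sdiff.isClosed_biUnion fun w _ => isClosed_eq (by fun_prop) (by fun_prop)).isOpen_compl,
    fun z hz => ?_⟩
  simp only [mem_compl_iff, mem_iUnion, mem_ofPred_eq, not_exists, Set.mem_sdiff, mem_singleton_iff]
  constructor
  · intro h
    obtain ⟨w, hw, hzw⟩ := hWx z
    have : w = coord x i / coord x 0 := by
      by_contra hne
      exact h w ⟨hw, hne⟩ hzw
    rw [hzw, this]
    field_simp
  · rintro h w ⟨-, hne⟩ hzw
    apply hne
    rw [eq_div_iff hx.ne']
    apply mul_right_cancel₀ hz.ne'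
    rw [← h, hzw]; ring

/-! ### Closed connected sets and hereditary unicoherence -/

variable {K L : Set (LinePaths Ω)}

/-- In a closed connected set, a point can be joined to points that do not lie further out on its
leg only through the points of the leg between it and the origin. -/
theorem scale_mem_of_isPreconnected (hK : IsClosed K) (hKp : IsPreconnected K)
    {x y : LinePaths Ω} (hx : x ∈ K) (hx0 : 0 < coord x 0) (hy : y ∈ K) {t : I} (ht0 : 0 < t)
    (ht1 : t < 1) (hxy : coord y 0 < t * coord x 0 ∨ ¬ SameLeg x y) : scale t x ∈ K := by
  by_contra hmem
  have ht0' : (0 : ℝ) < t := ht0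
  have ht1' : (t : ℝ) < 1 := ht1
  -- The `D n` decrease to `K ∩ {scale t x}`, which is assumed empty; by compactness some `D m` is
  -- already empty.
  let D : ℕ → Set (LinePaths Ω) := fun n => K ∩ {z | coord z 0 = t * coord x 0} ∩
    ⋂ i ∈ Iic n, {z | coord z i * coord x 0 = coord x i * coord z 0}
  have hDcl : ∀ n, IsClosed (D n) := fun n =>
    (hK.inter (isClosed_eq (by fun_prop) (by fun_prop))).inter
      (isClosed_biInter fun i _ => isClosed_eq (by fun_prop) (by fun_prop))
  obtain ⟨m, hm⟩ : ∃ m, ¬ (D m).Nonempty := by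
    by_contra! hne
    obtain ⟨z, hz⟩ := IsCompact.nonempty_iInter_of_sequence_nonempty_isCompact_isClosed D
      (fun n => inter_subset_inter_right _
        (biInter_subset_biInter_left (Iic_subset_Iic.2 n.le_succ)))
      hne (hDcl 0).isCompact hDcl
    rw [mem_iInter] at hz
    have hleg : SameLeg x z := fun i => mem_iInter₂.1 (hz i).2 i self_mem_Iic
    rw [hleg.eq_scale hx0 (hz 0).1.2] at hz
    exact hmem (hz 0).1.1
  -- Enough ratios are tested to also put `y` on the far side of the separation.
  obtain ⟨n, hmn, hn⟩ : ∃ n, m ≤ n ∧ (coord y 0 < t * coord x 0 ∨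
      ∃ i ≤ n, coord y i * coord x 0 ≠ coord x i * coord y 0) := by
    rcases hxy with h | h
    · exact ⟨m, le_rfl, Or.inl h⟩
    · obtain ⟨i, hi⟩ := not_forall.1 h
      exact ⟨max m i, le_max_left _ _, Or.inr ⟨i, le_max_right _ _, hi⟩⟩
  choose U hUo hU using fun i => exists_isOpen_agree hx0 i
  -- `V` is the part beyond `scale t x` that agrees with the leg up to `n`, and `V'` is the part
  -- that is lower or disagrees. They are disjoint, and they cover `K` because `D m` is empty.
  let V : Set (LinePaths Ω) := {z | t * coord x 0 < coord z 0} ∩ ⋂ i ∈ Iic n, U i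
  let V' : Set (LinePaths Ω) := {z | coord z 0 < t * coord x 0} ∪
    ⋃ i ∈ Iic n, {z | coord z i * coord x 0 ≠ coord x i * coord z 0}
  have hVo : IsOpen V := (isOpen_lt (by fun_prop) (by fun_prop)).inter
    ((finite_Iic n).isOpen_biInter fun i _ => hUo i)
  have hV'o : IsOpen V' := (isOpen_lt (by fun_prop) (by fun_prop)).union
    (isOpen_biUnion fun i _ => isOpen_ne_fun (by fun_prop) (by fun_prop))
  have hpos : 0 < (t : ℝ) * coord x 0 := mul_pos ht0' hx0
  have hcover : K ⊆ V ∪ V' := by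
    intro z hz
    by_cases hag : ∀ i ≤ n, coord z i * coord x 0 = coord x i * coord z 0
    · rcases lt_trichotomy (coord z 0) (t * coord x 0) with h | h | h
      · exact Or.inr (Or.inl h)
      · exact absurd ⟨z, ⟨hz, h⟩, mem_iInter₂.2 fun i hi => hag i (le_trans hi hmn)⟩ hm
      · exact Or.inl ⟨h, mem_iInter₂.2 fun i hi => (hU i z (hpos.trans h)).2 (hag i hi)⟩
    · push Not at hag
      obtain ⟨i, hi, h⟩ := hag
      exact Or.inr (Or.inr (mem_iUnion₂.2 ⟨i, hi, h⟩))
  obtain ⟨z, -, ⟨hz1, hz2⟩, hz3⟩ := hKp V V' hVo hV'o hcover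
    ⟨x, hx, show (t : ℝ) * coord x 0 < coord x 0 by nlinarith,
      mem_iInter₂.2 fun i _ => (hU i x hx0).2 rfl⟩
    ⟨y, hy, hn.imp id fun ⟨i, hi, h⟩ => mem_iUnion₂.2 ⟨i, hi, h⟩⟩
  rcases hz3 with h | h
  · rw [mem_ofPred_eq] at h hz1
    exact lt_asymm h hz1
  · obtain ⟨i, hi, h⟩ := mem_iUnion₂.1 h
    exact h ((hU i z (hpos.trans hz1)).1 (mem_iInter₂.1 hz2 i hi))

theorem SameLeg.scale_mem (hK : IsClosed K) (hKp : IsPreconnected K) {x y : LinePaths Ω}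
    (hleg : SameLeg x y) (hx : x ∈ K) (hx0 : 0 < coord x 0) (hy : y ∈ K) {t : I}
    (ht : coord y 0 ≤ t * coord x 0) : scale t x ∈ K := by
  rcases ht.eq_or_lt with h | h
  · rwa [← hleg.eq_scale hx0 h]
  rcases (unitInterval.le_one' (t := t)).eq_or_lt with rfl | ht1
  · rwa [scale_one]
  have ht0 : 0 < t := by
    refine unitInterval.pos_iff_ne_zero.2 ?_
    rintro rfl
    have := coord_nonneg y 0
    simp only [Icc.coe_zero, zero_mul] at h
    linarith
  exact scale_mem_of_isPreconnected hK hKp hx hx0 hy ht0 ht1 (Or.inl h)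

theorem coord_pos_of_not_sameLeg {x y : LinePaths Ω} (h : ¬ SameLeg x y) : 0 < coord x 0 := by
  refine (coord_nonneg x 0).lt_of_ne' fun h0 => h (sameLeg_of_coord_zero y h0).symm

theorem scale_mem_of_not_sameLeg (hK : IsClosed K) (hKp : IsPreconnected K) {x y : LinePaths Ω}
    (hleg : ¬ SameLeg x y) (hx : x ∈ K) (hy : y ∈ K) (t : I) : scale t x ∈ K := by
  have hx0 := coord_pos_of_not_sameLeg hleg
  have hsub : Ioo (0 : I) 1 ⊆ (fun t => scale t x) ⁻¹' K := fun t ht =>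
    scale_mem_of_isPreconnected hK hKp hx hx0 hy ht.1 ht.2 (Or.inr hleg)
  have := closure_minimal hsub (hK.preimage (continuous_scale_left x))
  rw [closure_Ioo zero_ne_one] at this
  exact this ⟨unitInterval.nonneg', unitInterval.le_one'⟩

theorem exists_connector_of_sameLeg {x y : LinePaths Ω} (hleg : SameLeg x y)
    (hle : coord y 0 ≤ coord x 0) :
    ∃ S : Set (LinePaths Ω), IsPreconnected S ∧ x ∈ S ∧ y ∈ S ∧
      ∀ K : Set (LinePaths Ω), IsClosed K → IsPreconnected K → x ∈ K → y ∈ K → S ⊆ K := by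
  rcases (coord_nonneg x 0).eq_or_lt with h0 | hx0
  · have : x = y := eq_of_coord_zero h0.symm (le_antisymm (h0 ▸ hle) (coord_nonneg y 0))
    subst this
    exact ⟨{x}, isPreconnected_singleton, rfl, rfl, fun K _ _ hx _ => singleton_subset_iff.2 hx⟩
  refine ⟨(fun t => scale t x) '' {t : I | coord y 0 ≤ t * coord x 0},
    IsPreconnected.image ?_ _ (continuous_scale_left x).continuousOn, ⟨1, by simpa, by simp⟩,
    ⟨⟨coord y 0 / coord x 0, div_nonneg (coord_nonneg y 0) hx0.le, (div_le_one hx0).2 hle⟩, ?_,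
      (hleg.eq_scale hx0 ?_).symm⟩, ?_⟩
  · refine OrdConnected.isPreconnected ⟨fun s hs t _ u hu => ?_⟩
    rw [mem_ofPred_eq] at hs ⊢
    exact hs.trans (mul_le_mul_of_nonneg_right hu.1 hx0.le)
  · simp [div_mul_cancel₀ _ hx0.ne']
  · simp [div_mul_cancel₀ _ hx0.ne']
  · rintro K hK hKp hx hy _ ⟨t, ht, rfl⟩
    exact hleg.scale_mem hK hKp hx hx0 hy ht

/-- Any two points lie in a connected set contained in all closed connected sets through them. -/
theorem exists_connector (x y : LinePaths Ω) :
    ∃ S : Set (LinePaths Ω), IsPreconnected S ∧ x ∈ S ∧ y ∈ S ∧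
      ∀ K : Set (LinePaths Ω), IsClosed K → IsPreconnected K → x ∈ K → y ∈ K → S ⊆ K := by
  by_cases hleg : SameLeg x y
  · rcases le_total (coord y 0) (coord x 0) with h | h
    · exact exists_connector_of_sameLeg hleg h
    · obtain ⟨S, hS, hy, hx, h⟩ := exists_connector_of_sameLeg hleg.symm h
      exact ⟨S, hS, hx, hy, fun K hK hKp hxK hyK => h K hK hKp hyK hxK⟩
  · refine ⟨range (fun t => scale t x) ∪ range (fun t => scale t y),
      IsPreconnected.union (scale 0 x) (mem_range_self _)
        ⟨0, eq_of_coord_zero (by simp) (by simp)⟩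
        (isPreconnected_range (continuous_scale_left x))
        (isPreconnected_range (continuous_scale_left y)),
      Or.inl ⟨1, scale_one x⟩, Or.inr ⟨1, scale_one y⟩, ?_⟩
    intro K hK hKp hx hy
    refine union_subset ?_ ?_ <;> rintro _ ⟨t, rfl⟩
    · exact scale_mem_of_not_sameLeg hK hKp hleg hx hy t
    · exact scale_mem_of_not_sameLeg hK hKp (fun h => hleg h.symm) hy hx t

instance : PreconnectedSpace (LinePaths Ω) := by
  refine ⟨isPreconnected_of_forall_pair fun x _ y _ => ?_⟩
  obtain ⟨S, hS, hx, hy, -⟩ := exists_connector x y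
  exact ⟨S, subset_univ _, hx, hy, hS⟩

/-- The connector of two points of `A ∩ B` lies in both `A` and `B`. That `A` and `B` meet at all
follows from the connectedness of `K`. -/
theorem isUnicoherent (hKs : IsSubcontinuum K) : IsUnicoherent K := by
  intro A B hA hB hAB
  constructor
  · have := isPreconnected_closed_iff.1 hKs.2.isPreconnected A B hA.1.isClosed hB.1.isClosed
      hAB.ge
      (by rw [← hAB, union_inter_cancel_left]; exact hA.2.nonempty)
      (by rw [← hAB, union_inter_cancel_right]; exact hB.2.nonempty)
    exact this.right
  · refine isPreconnected_of_forall_pair fun x hx y hy => ?_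
    obtain ⟨S, hS, hxS, hyS, hmin⟩ := exists_connector x y
    exact ⟨S, subset_inter (hmin A hA.1.isClosed hA.2.isPreconnected hx.1 hy.1)
      (hmin B hB.1.isClosed hB.2.isPreconnected hx.2 hy.2), hxS, hyS, hS⟩

/-! ### Arcs in the space of paths -/

theorem isArcBetween_scale {x : LinePaths Ω} (hx : 0 < coord x 0) :
    IsArcBetween (range fun t => scale t x) (scale 0 x) x := by
  simpa using isArcBetween_range (continuous_scale_left x) (scale_left_injective hx)

theorem exists_isArcBetween_of_sameLeg {x y : LinePaths Ω} (hleg : SameLeg x y)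
    (hlt : coord y 0 < coord x 0) : ∃ A, IsArcBetween A x y := by
  have hx0 : 0 < coord x 0 := (coord_nonneg y 0).trans_lt hlt
  let c : ℝ := coord y 0 / coord x 0
  have hc0 : 0 ≤ c := div_nonneg (coord_nonneg y 0) hx0.le
  have hc1 : c < 1 := (div_lt_one hx0).2 hlt
  let g : I → I := fun t => ⟨c + (1 - c) * t, by
    have := t.2.1
    have := t.2.2
    constructor <;> nlinarith⟩
  have hg : Continuous g := by
    refine Continuous.subtype_mk ?_ _
    fun_prop
  have hginj : Function.Injective g := fun s t h => by
    have h : c + (1 - c) * (s : ℝ) = c + (1 - c) * t := congrArg Subtype.val h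
    exact Subtype.ext (mul_left_cancel₀ (sub_pos.2 hc1).ne' (add_left_cancel h))
  have harc := isArcBetween_range ((continuous_scale_left x).comp hg)
    ((scale_left_injective hx0).comp hginj)
  have h0 : scale (g 0) x = y := by
    refine (hleg.eq_scale hx0 ?_).symm
    simp [g, c, div_mul_cancel₀ _ hx0.ne']
  have h1 : scale (g 1) x = x := coord_ext fun i => by simp [g]
  simp only [Function.comp_apply, h0, h1] at harc
  exact ⟨_, harc.symm⟩

/-- The arc runs down the leg of `x` to the origin at time `1/2`, then up the leg of `y`; distinct
legs meet only in the origin. -/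
theorem exists_isArcBetween_of_not_sameLeg {x y : LinePaths Ω} (hleg : ¬ SameLeg x y) :
    ∃ A, IsArcBetween A x y := by
  have hx0 := coord_pos_of_not_sameLeg hleg
  have hy0 := coord_pos_of_not_sameLeg fun h => hleg h.symm
  let p : ℝ → I := projIcc 0 1 zero_le_one
  have hp : Continuous p := continuous_projIcc
  have hpval : ∀ s : ℝ, 0 ≤ s → s ≤ 1 → (p s : ℝ) = s := fun s h0 h1 =>
    congrArg Subtype.val (projIcc_of_mem zero_le_one ⟨h0, h1⟩)
  let f : I → LinePaths Ω := fun t =>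
    if (t : ℝ) ≤ 1 / 2 then scale (p (1 - 2 * t)) x else scale (p (2 * t - 1)) y
  have hf : Continuous f := by
    refine Continuous.if_le ((continuous_scale_left x).comp (hp.comp (by fun_prop)))
      ((continuous_scale_left y).comp (hp.comp (by fun_prop))) (by fun_prop) (by fun_prop) ?_
    intro t ht
    apply eq_of_coord_zero <;> rw [coord_scale, hpval] <;> rw [ht] <;> norm_num
  have hcross : ∀ s t : I, (s : ℝ) ≤ 1 / 2 → ¬ (t : ℝ) ≤ 1 / 2 → f s ≠ f t := by
    intro s t hs ht h
    simp only [f, if_pos hs, if_neg ht] at h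
    have hts := t.2.2
    have hs0 := s.2.1
    have ht' : 0 < p (2 * t - 1) := by
      rw [← Subtype.coe_lt_coe, hpval _ (by linarith) (by linarith), Icc.coe_zero]
      linarith
    have hs' : 0 < p (1 - 2 * s) := by
      refine unitInterval.pos_iff_ne_zero.2 fun h0 => ?_
      have h' := congrArg (coord · 0) h
      simp only [coord_scale, h0, Icc.coe_zero, zero_mul] at h'
      exact (mul_pos (show (0 : ℝ) < _ from ht') hy0).ne h'
    exact hleg (sameLeg_of_scale_eq_scale hs' ht' h)
  have hinj : Function.Injective f := by
    intro s t h
    have hs0 := s.2.1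
    have hs1 := s.2.2
    have ht0 := t.2.1
    have ht1 := t.2.2
    by_cases hs : (s : ℝ) ≤ 1 / 2 <;> by_cases ht : (t : ℝ) ≤ 1 / 2
    · simp only [f, if_pos hs, if_pos ht] at h
      have := congrArg Subtype.val (scale_left_injective hx0 h)
      rw [hpval _ (by linarith) (by linarith), hpval _ (by linarith) (by linarith)] at this
      exact Subtype.ext (by linarith)
    · exact absurd h (hcross s t hs ht)
    · exact absurd h.symm (hcross t s ht hs)
    · simp only [f, if_neg hs, if_neg ht] at h
      have := congrArg Subtype.val (scale_left_injective hy0 h)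
      rw [hpval _ (by linarith) (by linarith), hpval _ (by linarith) (by linarith)] at this
      exact Subtype.ext (by linarith)
  have h0 : f 0 = x := coord_ext fun i => by simp [f, hpval]
  have h1 : f 1 = y := by
    have : ¬ ((1 : I) : ℝ) ≤ 1 / 2 := by norm_num
    refine coord_ext fun i => ?_
    simp only [f, if_neg this, coord_scale]
    rw [hpval] <;> norm_num
  have harc := isArcBetween_range hf hinj
  rw [h0, h1] at harc
  exact ⟨_, harc⟩

theorem exists_isArcBetween {x y : LinePaths Ω} (hne : x ≠ y) : ∃ A, IsArcBetween A x y := by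
  by_cases hleg : SameLeg x y
  · rcases lt_trichotomy (coord x 0) (coord y 0) with h | h | h
    · obtain ⟨A, hA⟩ := exists_isArcBetween_of_sameLeg hleg.symm h
      exact ⟨A, hA.symm⟩
    · rcases (coord_nonneg x 0).eq_or_lt with h0 | h0
      · exact absurd (eq_of_coord_zero h0.symm (h ▸ h0.symm)) hne
      · refine absurd ?_ hne
        rw [hleg.eq_scale h0 (t := 1) (by simp [h]), scale_one]
    · exact exists_isArcBetween_of_sameLeg hleg h
  · exact exists_isArcBetween_of_not_sameLeg hleg

/-- The set `K` extends from `x` along its leg towards the origin. -/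
def ExtendsInward (K : Set (LinePaths Ω)) (x : LinePaths Ω) : Prop :=
  ∃ t₀ : I, t₀ < 1 ∧ ∀ t : I, t₀ < t → t < 1 → scale t x ∈ K

/-- Unless `y` lies further out on the leg of `x`, joining `x` to `y` inside `K` requires moving
inward first. -/
theorem exists_eq_scale_or_extendsInward (hK : IsClosed K) (hKp : IsPreconnected K)
    {x y : LinePaths Ω} (hx : x ∈ K) (hx0 : 0 < coord x 0) (hy : y ∈ K) (hne : y ≠ x) :
    (∃ s : I, s < 1 ∧ x = scale s y) ∨ ExtendsInward K x := by
  by_cases hleg : SameLeg x y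
  · rcases lt_trichotomy (coord x 0) (coord y 0) with h | h | h
    · have hy0 := hx0.trans h
      refine Or.inl ⟨⟨coord x 0 / coord y 0, div_nonneg hx0.le hy0.le,
        ((div_lt_one hy0).2 h).le⟩, (div_lt_one hy0).2 h, hleg.symm.eq_scale hy0 ?_⟩
      exact (div_mul_cancel₀ _ hy0.ne').symm
    · refine absurd ?_ hne
      rw [hleg.eq_scale hx0 (t := 1) (by simp [h]), scale_one]
    · refine Or.inr ⟨⟨coord y 0 / coord x 0, div_nonneg (coord_nonneg y 0) hx0.le,
        ((div_lt_one hx0).2 h).le⟩, (div_lt_one hx0).2 h, fun t ht _ => ?_⟩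
      refine hleg.scale_mem hK hKp hx hx0 hy ?_
      exact (div_le_iff₀ hx0).1 (show coord y 0 / coord x 0 < t from ht).le
  · exact Or.inr ⟨0, zero_lt_one, fun t _ _ => scale_mem_of_not_sameLeg hK hKp hleg hx hy t⟩

theorem ExtendsInward.inter_ne_singleton {x : LinePaths Ω} (hx0 : 0 < coord x 0)
    (hK : ExtendsInward K x) (hL : ExtendsInward L x) : K ∩ L ≠ {x} := by
  obtain ⟨s, hs, hK⟩ := hK
  obtain ⟨t, ht, hL⟩ := hL
  obtain ⟨u, hu, hu1⟩ := exists_between (max_lt hs ht)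
  rw [max_lt_iff] at hu
  intro h
  have hmem : scale u x ∈ K ∩ L := ⟨hK u hu.1 hu1, hL u hu.2 hu1⟩
  rw [h, mem_singleton_iff] at hmem
  exact hu1.ne (scale_left_injective hx0 (hmem.trans (scale_one x).symm))

/-- Two sets that both reach outward from `x` overlap: the nearer outer point `y` lies between `x`
and `z`, hence also in `K`. -/
theorem inter_ne_singleton_of_eq_scale (hK : IsClosed K) (hKp : IsPreconnected K)
    {x y z : LinePaths Ω} (hx : x ∈ K) (hx0 : 0 < coord x 0) (hy : y ∈ L) (hz : z ∈ K) {s t : I}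
    (hs : s < 1) (hxy : x = scale s y) (hxz : x = scale t z) (hyz : coord y 0 ≤ coord z 0) :
    K ∩ L ≠ {x} := by
  have hs1 : (s : ℝ) < 1 := hs
  have h1 : coord x 0 = s * coord y 0 := congrArg (coord · 0) hxy
  have h2 : coord x 0 = t * coord z 0 := congrArg (coord · 0) hxz
  have hspos : 0 < s := unitInterval.pos_iff_ne_zero.2 fun h => by
    rw [h1, h] at hx0; simp at hx0
  have htpos : 0 < t := unitInterval.pos_iff_ne_zero.2 fun h => by
    rw [h2, h] at hx0; simp at hx0
  have hy0 : 0 < coord y 0 := by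
    rw [h1] at hx0
    exact pos_of_mul_pos_right hx0 s.2.1
  have hz0 := hy0.trans_le hyz
  have hxy_lt : coord x 0 < coord y 0 := by nlinarith
  let c : I := ⟨coord y 0 / coord z 0, div_nonneg hy0.le hz0.le, (div_le_one hz0).2 hyz⟩
  have hc : coord y 0 = c * coord z 0 := (div_mul_cancel₀ _ hz0.ne').symm
  have hleg : SameLeg z y := (sameLeg_of_scale_eq_scale hspos htpos (hxy.symm.trans hxz)).symm
  have hlegx : SameLeg z x := fun i => by rw [hxz, coord_scale, coord_scale]; ring
  have hyK : y ∈ K := by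
    rw [hleg.eq_scale hz0 hc]
    exact hlegx.scale_mem hK hKp hz hz0 hx (hc ▸ hxy_lt.le)
  intro h
  have hmem : y ∈ K ∩ L := ⟨hyK, hy⟩
  rw [h, mem_singleton_iff] at hmem
  exact hxy_lt.ne (by rw [hmem])

theorem ExtendsInward.or_of_inter_eq_singleton {x y z : LinePaths Ω} (hK : IsSubcontinuum K)
    (hL : IsSubcontinuum L) (hx0 : 0 < coord x 0) (hKL : K ∩ L = {x}) (hy : y ∈ K) (hyx : y ≠ x)
    (hz : z ∈ L) (hzx : z ≠ x) : ExtendsInward K x ∨ ExtendsInward L x := by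
  have hx : x ∈ K ∩ L := hKL ▸ mem_singleton x
  rcases exists_eq_scale_or_extendsInward hK.1.isClosed hK.2.isPreconnected hx.1 hx0 hy hyx with
    ⟨s, hs, hxy⟩ | h
  · rcases exists_eq_scale_or_extendsInward hL.1.isClosed hL.2.isPreconnected hx.2 hx0 hz hzx with
      ⟨t, ht, hxz⟩ | h
    · exfalso
      rcases le_total (coord y 0) (coord z 0) with hle | hle
      · exact inter_ne_singleton_of_eq_scale hL.1.isClosed hL.2.isPreconnected hx.2 hx0 hy hz hs
          hxy hxz hle (by rw [inter_comm, hKL])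
      · exact inter_ne_singleton_of_eq_scale hK.1.isClosed hK.2.isPreconnected hx.1 hx0 hz hy ht
          hxz hxy hle hKL
    · exact Or.inr h
  · exact Or.inl h

theorem coord_zero_of_isRamificationPoint {x : LinePaths Ω} (h : IsRamificationPoint x) :
    coord x 0 = 0 := by
  by_contra hne
  have hx0 : 0 < coord x 0 := (coord_nonneg x 0).lt_of_ne' hne
  obtain ⟨A, B, C, ⟨a, hA⟩, ⟨b, hB⟩, ⟨c, hC⟩, hAB, hAC, hBC⟩ := h
  have h1 := ExtendsInward.or_of_inter_eq_singleton hA.isSubcontinuum hB.isSubcontinuum hx0 hAB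
    hA.symm.left_mem hA.ne.symm hB.symm.left_mem hB.ne.symm
  have h2 := ExtendsInward.or_of_inter_eq_singleton hA.isSubcontinuum hC.isSubcontinuum hx0 hAC
    hA.symm.left_mem hA.ne.symm hC.symm.left_mem hC.ne.symm
  have h3 := ExtendsInward.or_of_inter_eq_singleton hB.isSubcontinuum hC.isSubcontinuum hx0 hBC
    hB.symm.left_mem hB.ne.symm hC.symm.left_mem hC.ne.symm
  have n1 := fun ha hb => ExtendsInward.inter_ne_singleton (K := A) (L := B) hx0 ha hb hAB
  have n2 := fun ha hb => ExtendsInward.inter_ne_singleton (K := A) (L := C) hx0 ha hb hAC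
  have n3 := fun ha hb => ExtendsInward.inter_ne_singleton (K := B) (L := C) hx0 ha hb hBC
  -- Of any two of the three arcs exactly one extends inward, which is impossible for three arcs.
  tauto

/-- A coordinate equal to 1 rules out any point further out on the leg. If the point were interior
to an arc, both halves of the arc would extend inward and overlap. -/
theorem isEndpoint_of_coord_eq_one {x : LinePaths Ω}
    (hx0 : 0 < coord x 0) {i : ℕ} (hi : coord x i = 1) : IsEndpoint x := by
  rintro A ⟨e⟩ hxA
  have hA : IsArcBetween A (e 0) (e 1) := ⟨e, rfl, rfl⟩
  obtain ⟨f, hf, rfl, h0, h1⟩ := hA.exists_param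
  rw [← h0, ← h1] at hA
  obtain ⟨s, rfl⟩ := hxA
  rcases (unitInterval.nonneg' (t := s)).eq_or_lt with rfl | hs0
  · exact ⟨_, hA⟩
  rcases (unitInterval.le_one' (t := s)).eq_or_lt with rfl | hs1
  · exact ⟨_, hA.symm⟩
  exfalso
  have houter : ∀ y, ¬ ∃ t : I, t < 1 ∧ f s = scale t y := by
    rintro y ⟨t, ht, h⟩
    have ht' : (t : ℝ) < 1 := ht
    have := congrArg (coord · i) h
    simp only [coord_scale, hi] at this
    nlinarith [coord_le_one y i, coord_nonneg y i, t.2.1]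
  have hinward : ∀ (a b u : I), s ∈ Icc a b → u ∈ Icc a b → u ≠ s →
      ExtendsInward (f '' Icc a b) (f s) := fun a b u hs hu hne =>
    (exists_eq_scale_or_extendsInward (isCompact_Icc.image hf.continuous).isClosed
      (isPreconnected_Icc.image _ hf.continuous.continuousOn) (mem_image_of_mem f hs) hx0
      (mem_image_of_mem f hu) (hf.injective.ne hne)).resolve_left (houter _)
  refine (hinward 0 s 0 ⟨hs0.le, le_rfl⟩ ⟨le_rfl, hs0.le⟩ hs0.ne).inter_ne_singleton hx0
    (hinward s 1 1 ⟨le_rfl, hs1.le⟩ ⟨hs1.le, le_rfl⟩ hs1.ne') ?_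
  rw [← image_inter hf.injective, Icc_inter_Icc_eq_singleton hs0.le hs1.le, image_singleton]

/-! ### Smoothness -/

/-- The segment from the origin to `x`. -/
def leg (x : LinePaths Ω) : NonemptyCompacts (LinePaths Ω) :=
  NonemptyCompacts.map _ continuous_scale (⊤ ×ˢ {x})

theorem coe_leg (x : LinePaths Ω) : (leg x : Set (LinePaths Ω)) = range fun t => scale t x := by
  ext z
  simp [leg]

theorem continuous_leg : Continuous (leg : LinePaths Ω → NonemptyCompacts (LinePaths Ω)) :=
  continuous_scale.nonemptyCompacts_map.comp (NonemptyCompacts.continuous_prod.comp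
    (continuous_const.prodMk NonemptyCompacts.continuous_singleton))

/-- The arc, being closed and connected, contains the whole leg; being irreducible between its
end-points, it is no larger. -/
theorem eq_leg_of_isSegment {v x : LinePaths Ω} (hv : coord v 0 = 0)
    {A : NonemptyCompacts (LinePaths Ω)} (hA : IsSegment (A : Set (LinePaths Ω)) v x) :
    A = leg x := by
  apply SetLike.coe_injective
  rw [coe_leg]
  have h0 : scale 0 x = v := eq_of_coord_zero (by simp) hv
  rcases hA with ⟨hne, hA⟩ | ⟨rfl, hA⟩
  · have hx0 : 0 < coord x 0 :=
      (coord_nonneg x 0).lt_of_ne' fun h => hne (eq_of_coord_zero hv h)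
    have hsub : (range fun t => scale t x) ⊆ (A : Set (LinePaths Ω)) := by
      rintro _ ⟨t, rfl⟩
      refine (sameLeg_of_coord_zero x hv).scale_mem hA.isSubcontinuum.1.isClosed
        hA.isSubcontinuum.2.isPreconnected hA.symm.left_mem hx0 hA.left_mem ?_
      rw [hv]
      exact mul_nonneg t.2.1 hx0.le
    exact (hA.subset_of_isPreconnected hsub (isPreconnected_range (continuous_scale_left x))
      ⟨0, h0⟩ ⟨1, scale_one x⟩).antisymm hsub
  · rw [hA]
    have : ∀ t, scale t v = v := fun t => eq_of_coord_zero (by simp [hv]) hv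
    simp [this]

/-! ### Construction of paths -/

theorem exists_cons {x : LinePaths Ω} {u ω : ℝ} (hu : u ∈ Icc (0 : ℝ) 1) (hω : ω ∈ Ω)
    (hx : coord x 0 = ω * u) :
    ∃ y : LinePaths Ω, coord y 0 = u ∧ ∀ i, coord y (i + 1) = coord x i := by
  obtain ⟨y, hy⟩ := exists_coord_eq (Ω := Ω) (fun i => Nat.casesOn i u (coord x))
    (fun i => by
      cases i with
      | zero => exact hu
      | succ i => exact ⟨coord_nonneg x i, coord_le_one x i⟩)
    (fun i => by
      cases i with
      | zero => exact ⟨ω, hω, hx⟩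
      | succ i => exact coord_succ x i)
  exact ⟨y, hy 0, fun i => hy (i + 1)⟩

theorem exists_geometric {r : ℝ} (hr : r ∈ Ω) (h0 : 0 ≤ r) (h1 : r ≤ 1) :
    ∃ x : LinePaths Ω, ∀ i, coord x i = r ^ i :=
  exists_coord_eq _ (fun i => ⟨pow_nonneg h0 i, pow_le_one₀ h0 h1⟩)
    fun i => ⟨r, hr, pow_succ' r i⟩

/-- A rescaled initial part of one path, followed by another path. -/
theorem exists_append (x z : LinePaths Ω) (c : I) (n : ℕ) (hz : coord z 0 = c * coord x n) :
    ∃ y : LinePaths Ω, (∀ i ≤ n, coord y i = c * coord x i) ∧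
      ∀ i, coord y (n + i) = coord z i := by
  obtain ⟨y, hy⟩ := exists_coord_eq (Ω := Ω)
    (fun i => if i ≤ n then coord (scale c x) i else coord z (i - n))
    (fun i => by
      split_ifs
      · exact ⟨coord_nonneg _ i, coord_le_one _ i⟩
      · exact ⟨coord_nonneg _ _, coord_le_one _ _⟩)
    (fun i => by
      rcases lt_trichotomy i n with h | rfl | h
      · rw [if_pos h.le, if_pos (Nat.succ_le_of_lt h)]
        exact coord_succ _ _
      · rw [if_pos le_rfl, if_neg (by omega), coord_scale, ← hz, Nat.add_sub_cancel_left]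
        exact coord_succ z 0
      · rw [if_neg (by omega), if_neg (by omega), Nat.sub_add_comm h.le]
        exact coord_succ z _)
  refine ⟨y, fun i hi => by rw [hy, if_pos hi, coord_scale], fun i => ?_⟩
  rw [hy]
  rcases Nat.eq_zero_or_pos i with rfl | h
  · rw [Nat.add_zero, if_pos le_rfl, coord_scale, hz]
  · rw [if_neg (by omega), Nat.add_sub_cancel_left]

/-- The `r`-steps come first, so the coordinates fall and then climb under `ρ` to the final value 1,
never exceeding it. From there the path decays with slope `r`. -/
theorem exists_coord_eq_one {r ρ : ℝ} (h : NeverConnect r ρ) (hr : r ∈ Ω) (hρ : ρ ∈ Ω) (k l : ℕ)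
    (u : ℝ) (hu0 : 0 ≤ u) (hu1 : u ≤ 1) (hu : u * (r ^ k * ρ ^ l) = 1) :
    ∃ z : LinePaths Ω, coord z 0 = u ∧ ∃ i, coord z i = 1 := by
  have hρ0 : 0 < ρ := zero_lt_one.trans h.one_lt
  induction k generalizing u with
  | zero =>
    induction l generalizing u with
    | zero =>
      obtain ⟨z, hz⟩ := exists_geometric hr h.pos.le h.lt_one.le
      exact ⟨z, by rw [hz]; linarith, 0, by simp [hz]⟩
    | succ l ih =>
      have hu' : ρ * u * ρ ^ l = 1 := by rw [← hu]; ring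
      have hle : ρ * u ≤ 1 := by
        rw [← hu']
        exact le_mul_of_one_le_right (by positivity) (one_le_pow₀ h.one_lt.le)
      obtain ⟨z, hz, i, hi⟩ := ih (ρ * u) (by positivity) hle (by simpa using hu')
      obtain ⟨y, hy, hyz⟩ := exists_cons ⟨hu0, hu1⟩ hρ hz
      exact ⟨y, hy, i + 1, by rw [hyz, hi]⟩
  | succ k ih =>
    obtain ⟨z, hz, i, hi⟩ := ih (r * u) (mul_nonneg h.pos.le hu0)
      (mul_le_one₀ h.lt_one.le hu0 hu1) (by rw [← hu]; ring)
    obtain ⟨y, hy, hyz⟩ := exists_cons ⟨hu0, hu1⟩ hr hz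
    exact ⟨y, hy, i + 1, by rw [hyz, hi]⟩

/-! ### The Lelek fan -/

theorem leg_inter_leg {x y v : LinePaths Ω} (hv : coord v 0 = 0) (hxy : ¬ SameLeg x y) :
    (range fun t => scale t x) ∩ (range fun t => scale t y) = {v} := by
  refine Subset.antisymm ?_ (singleton_subset_iff.2
    ⟨⟨0, eq_of_coord_zero (by simp) hv⟩, ⟨0, eq_of_coord_zero (by simp) hv⟩⟩)
  rintro _ ⟨⟨s, rfl⟩, ⟨t, h⟩⟩
  refine eq_of_coord_zero ?_ hv
  have h0 := congrArg (coord · 0) h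
  simp only [coord_scale] at h0 ⊢
  rcases (unitInterval.nonneg' (t := s)).eq_or_lt with rfl | hs
  · simp
  rcases (unitInterval.nonneg' (t := t)).eq_or_lt with rfl | ht
  · rw [← h0]; simp
  · exact absurd (sameLeg_of_scale_eq_scale hs ht h.symm) hxy

theorem isRamificationPoint_of_coord_zero {r ρ : ℝ} (h : NeverConnect r ρ) (hr : r ∈ Ω)
    (hρ : ρ ∈ Ω) {v : LinePaths Ω} (hv : coord v 0 = 0) : IsRamificationPoint v := by
  have hρ0 : 0 < ρ := zero_lt_one.trans h.one_lt
  have hinv : ρ⁻¹ ≤ 1 := inv_le_one_of_one_le₀ h.one_lt.le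
  have hrρ : r ≠ ρ := (h.lt_one.trans h.one_lt).ne
  -- Three distinct legs, with slope sequences `r, r, r, …`, then `ρ, r, r, …`, then `ρ, ρ, r, …`.
  -- The starting values `1`, `ρ⁻¹`, `ρ⁻¹ * ρ⁻¹` make each path peak at exactly 1.
  obtain ⟨x, hx⟩ := exists_geometric hr h.pos.le h.lt_one.le
  obtain ⟨y, hy0, hy⟩ := exists_cons (x := x) (u := ρ⁻¹) ⟨by positivity, hinv⟩ hρ
    (by rw [hx, mul_inv_cancel₀ hρ0.ne', pow_zero])
  obtain ⟨z, hz0, hz⟩ := exists_cons (x := y) (u := ρ⁻¹ * ρ⁻¹)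
    ⟨by positivity, mul_le_one₀ hinv (by positivity) hinv⟩ hρ
    (by rw [hy0]; field_simp)
  have hxy : ¬ SameLeg x y := fun hs => by
    have := hs 1
    rw [hy 0, hy0, hx, hx] at this
    field_simp at this
    exact hrρ (by linarith)
  have hxz : ¬ SameLeg x z := fun hs => by
    have := hs 1
    rw [hz 0, hy0, hz0, hx, hx] at this
    field_simp at this
    exact hrρ (by linarith)
  have hyz : ¬ SameLeg y z := fun hs => by
    have := hs 2
    rw [hz 1, hy 0, hy 1, hy0, hz0, hx, hx] at this
    field_simp at this
    exact hrρ (by linarith)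
  have harc : ∀ w : LinePaths Ω, 0 < coord w 0 →
      IsEndpointOfArc (range fun t => scale t w) v := fun w hw => by
    rw [← eq_of_coord_zero (x := scale 0 w) (by simp) hv]
    exact ⟨w, isArcBetween_scale hw⟩
  exact ⟨_, _, _, harc x (coord_pos_of_not_sameLeg hxy), harc y (coord_pos_of_not_sameLeg hyz),
    harc z (coord_pos_of_not_sameLeg fun h => hyz h.symm), leg_inter_leg hv hxy,
    leg_inter_leg hv hxz, leg_inter_leg hv hyz⟩

theorem mem_closure_isEndpoint_of_pos (hΩ : ∀ ω ∈ Ω, 0 < ω) {r ρ : ℝ} (h : NeverConnect r ρ)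
    (hr : r ∈ Ω) (hρ : ρ ∈ Ω) {x : LinePaths Ω} (hx0 : 0 < coord x 0) :
    x ∈ closure {y : LinePaths Ω | IsEndpoint y} := by
  have key : ∀ n : ℕ, ∃ (y : LinePaths Ω) (c : ℝ), IsEndpoint y ∧ 1 - 1 / ((n : ℝ) + 2) ≤ c ∧
      c ≤ 1 ∧ ∀ i ≤ n, coord y i = c * coord x i := by
    intro n
    have hxn := coord_pos hΩ hx0 n
    have hn : (0 : ℝ) < 1 - 1 / ((n : ℝ) + 2) := by
      rw [sub_pos, div_lt_one (by positivity)]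
      linarith [n.cast_nonneg (α := ℝ)]
    have hn1 : 1 - 1 / ((n : ℝ) + 2) < 1 := sub_lt_self _ (by positivity)
    -- The interval is chosen so that `c = 1 / (q * coord x n)` falls between `1 - 1 / (n + 2)` and
    -- 1. The shift by 2 keeps the lower bound positive at `n = 0`.
    obtain ⟨k, l, hlow, hhigh⟩ := h.exists_pow_mul_pow_mem_Ioo
      (a := 1 / coord x n) (b := 1 / ((1 - 1 / ((n : ℝ) + 2)) * coord x n)) (by positivity)
      (one_div_lt_one_div_of_lt (by positivity) (mul_lt_of_lt_one_left hxn hn1))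
    rw [div_lt_iff₀ hxn] at hlow
    rw [lt_div_iff₀ (by positivity)] at hhigh
    set q := r ^ k * ρ ^ l
    have hq : 0 < q := mul_pos (pow_pos h.pos _) (pow_pos (zero_lt_one.trans h.one_lt) _)
    let c : ℝ := 1 / (q * coord x n)
    have hc1 : c ≤ 1 := (div_le_one (by positivity)).2 hlow.le
    have hcn : 1 - 1 / ((n : ℝ) + 2) ≤ c := by
      rw [le_div_iff₀ (by positivity)]
      linarith
    have hc0 : 0 < c := hn.trans_le hcn
    obtain ⟨z, hz, i, hi⟩ := exists_coord_eq_one h hr hρ k l (c * coord x n) (by positivity)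
      (mul_le_one₀ hc1 hxn.le (coord_le_one x n))
      (by simp only [c]; change _ * q = 1; field_simp)
    obtain ⟨y, hyx, hyz⟩ := exists_append x z ⟨c, hc0.le, hc1⟩ n hz
    refine ⟨y, c, isEndpoint_of_coord_eq_one ?_ ((hyz i).trans hi), hcn, hc1, hyx⟩
    rw [hyx 0 n.zero_le]
    exact mul_pos hc0 hx0
  choose y c hy hcn hc1 hyx using key
  have hc : Tendsto c atTop (𝓝 1) := by
    refine tendsto_of_tendsto_of_tendsto_of_le_of_le ?_ tendsto_const_nhds hcn hc1
    have : Tendsto (fun n : ℕ => (1 : ℝ) / ((n : ℝ) + 2)) atTop (𝓝 0) :=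
      tendsto_const_nhds.div_atTop (tendsto_atTop_add_const_right _ _ tendsto_natCast_atTop_atTop)
    simpa using tendsto_const_nhds.sub this
  refine mem_closure_of_tendsto (f := y) (b := atTop) ?_ (Eventually.of_forall hy)
  rw [tendsto_subtype_rng, tendsto_pi_nhds]
  intro i
  rw [tendsto_subtype_rng]
  have : Tendsto (fun n => c n * coord x i) atTop (𝓝 (1 * coord x i)) := hc.mul_const _
  rw [one_mul] at this
  refine this.congr' ?_
  filter_upwards [eventually_ge_atTop i] with n hn
  exact (hyx n i hn).symm

theorem dense_isEndpoint (hΩ : ∀ ω ∈ Ω, 0 < ω) {r ρ : ℝ} (h : NeverConnect r ρ)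
    (hr : r ∈ Ω) (hρ : ρ ∈ Ω) : Dense {y : LinePaths Ω | IsEndpoint y} := by
  intro x
  rcases (coord_nonneg x 0).eq_or_lt with h0 | hx0
  -- The origin is the limit of the nonzero points `scale t z` as `t → 0`, and these are already in
  -- the closure.
  · obtain ⟨z, hz⟩ := exists_geometric hr h.pos.le h.lt_one.le
    have hsub : Ioo (0 : I) 1 ⊆
        (fun t => scale t z) ⁻¹' closure {y : LinePaths Ω | IsEndpoint y} := fun t ht =>
      mem_closure_isEndpoint_of_pos hΩ h hr hρ
        (by simpa [hz] using show (0 : ℝ) < t from ht.1)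
    have hcl := closure_minimal hsub (isClosed_closure.preimage (continuous_scale_left z))
    rw [closure_Ioo zero_ne_one] at hcl
    rw [← eq_of_coord_zero (x := scale 0 z) (by simp) h0.symm]
    exact hcl ⟨le_rfl, unitInterval.le_one'⟩
  · exact mem_closure_isEndpoint_of_pos hΩ h hr hρ hx0

end LinePaths

theorem mainTheorem2 (Ω : Finset ℝ) (hΩ : LFInducing Ω) :
    IsLelekFan (MahavierProduct (lineRelation Ω)) := by
  obtain ⟨r, hr, ρ, hρ, h⟩ := hΩ.exists_neverConnect
  obtain ⟨x, -⟩ := LinePaths.exists_geometric hr h.pos.le h.lt_one.le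
  exact
    { compact := inferInstance
      connected := { toNonempty := ⟨x⟩ }
      metrizable := inferInstance
      arcwise_connected := fun _ _ => LinePaths.exists_isArcBetween
      hereditarily_unicoherent := fun _ => LinePaths.isUnicoherent
      existsUnique_top :=
        ⟨LinePaths.scale 0 x, LinePaths.isRamificationPoint_of_coord_zero h hr hρ (by simp),
          fun v hv => LinePaths.eq_of_coord_zero (LinePaths.coord_zero_of_isRamificationPoint hv)
            (by simp)⟩
      smooth := by
        intro v hv x x₀ hx A A₀ hA hA₀
        have hv0 := LinePaths.coord_zero_of_isRamificationPoint hv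
        rw [LinePaths.eq_leg_of_isSegment hv0 hA₀,
          funext fun n => LinePaths.eq_leg_of_isSegment hv0 (hA n)]
        exact (LinePaths.continuous_leg.tendsto x₀).comp hx
      dense_endpoints := LinePaths.dense_isEndpoint hΩ.pos h hr hρ }
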